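/- **Theorem 4 (Optimality of stationary policies, finite-memory decoder).** Let $\mathcal U,\mathcal X,\mathcal Y,\mathcal Z,\hat{\mathcal U}$ be finite non-empty alphabets, $d\ge 0$ a lookahead, $P_U$ a law on $\mathcal U$, $P_{Y|X}$ a memoryless channel, $f_m:\mathcal Z\times\mathcal Y\to\mathcal Z$ a fixed memory update, and $\Lambda:\mathcal U\times\hat{\mathcal U}\to\mathbb R$ a distortion function. The initial state $((U_0,\dots,U_d),Z_0)$ has some law $\nu$; $U_{d+1},U_{d+2},\dots$ are i.i.d. $\sim P_U$ and independent of it. For $i\ge1$ an encoder produces $X_i=f_{e,i}(Z_0,U_0^{i+d},Y^{i-1})$; given this and the past, $Y_i\sim P_{Y|X}(\cdot|X_i)$; then $Z_i=f_m(Z_{i-1},Y_i)$ and $\hat U_i=f_d(Y_i,Z_{i-1})$, where the decoder $f_d:\mathcal Y\times\mathcal Z\to\hat{\mathcal U}$ is stationary. The expected average distortion is $\limsup_{N}\frac1N\sum_{i=1}^N\mathbb E\,\Lambda(U_i,\hat U_i)$. With $V_i=(U_i,\dots,U_{i+d})$, the associated controlled Markov process has states $S_i=(V_i,Z_i)$,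 actions $a:\mathcal U^{d+1}\to\mathcal X$ (with $X_i=A_i(V_i)$), disturbances $W_i=(V_i,Y_i)$, and reward $$g\big((u_1,\dots,u_{d+1},z),a\big)=-\sum_{\tilde u,\tilde y}P_U(\tilde u)P_{Y|X}(\tilde y|a(u_2,\dots,u_{d+1},\tilde u))\,\Lambda(u_2,f_d(\tilde y,z)),$$ where $u_2$ means $\tilde u$ if $d=0$. Its policies are the history-dependent deterministic ones, $A_i=\pi_i(S_0,W^{i-1})$, and its average reward is $J(\nu,\pi)=\liminf_N\frac1N\sum_{i=1}^N\mathbb E\,g(S_{i-1},A_i)$. Its average cost optimality equation (ACOE), for $\lambda\in\mathbb R$ and $h:\mathcal U^{d+1}\times\mathcal Z\to\mathbb R$, is $$\lambda+h(u_1,\dots,u_{d+1},z)=\max_{a}\sum_{\tilde u,\tilde y}P_U(\tilde u)P_{Y|X}(\tilde y|a(u_2,\dots,u_{d+1},\tilde u))\big\{h(u_2,\dots,u_{d+1},\tilde u,f_m(z,\tilde y))-\Lambda(u_2,f_d(\tilde y,z))\big\}$$ for all $(u_1,\dots,u_{d+1})\in\mathcal U^{d+1}$ and $z\in\mathcal Z$.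 Then: 1. For every stationary decoder $f_d$ (in particular for an optimal one) there is a map $\mu$ from states to actions whose stationary policy $A_i=\mu(S_{i-1})$ maximises $J(\nu,\cdot)$ among all history-dependent policies, for every initial law $\nu$ simultaneously; for some $\nu$ it moreover attains $\sup_{\nu',\pi'}J(\nu',\pi')$. The stationary encoder $X_i=\mu(U_{i-1}^{i+d},Z_{i-1})$, that is $X_i=\mu(U_{i-1}^{i+d-1},Z_{i-1})(U_i^{i+d})$, minimises the expected average distortion among all encoders, for every $\nu$. 2. For every $\nu$, some stationary encoder of this form together with some stationary decoder minimises the expected average distortion among all pairs of an encoder and a stationary decoder. 3. If $(\lambda,h)$ solves the ACOE for $f_d$, then some $\mu$ attains the maximum in it at all states, and for every such $\mu$ and every $\nu$ the stationary policy of $\mu$ has average reward $\lambda$ and is optimal, and the encoder $X_i=\mu(U_{i-1}^{i+d},Z_{i-1})$ has expected average distortion $-\lambda$ and is optimal. -/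

import Mathlib

noncomputable section

namespace RealTimeCoding

open Filter

/-- Expectation of a real function under a probability mass function on a finite set. -/
def expect {α : Type*} [Fintype α] (p : PMF α) (f : α → ℝ) : ℝ :=
  ∑ x, (p x).toReal * f x

/-! ### Controlled Markov processes with average reward -/

/-- A controlled Markov process `s_t = F (s_{t-1}, a_t, w_t)`, where the disturbance `w_t` has law
`PW (· | s_{t-1}, a_t)` given the past, with one-stage reward `g (s_{t-1}, a_t)`.
Every action is admissible in every state. -/
structure ControlledMarkovProcess (S A W : Type*) where
  /-- system dynamics -/
  F : S → A → W → S
  /-- law of the disturbance given the previous state and the current action -/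
  PW : S → A → PMF W
  /-- one-stage reward -/
  g : S → A → ℝ

/-- History-dependent deterministic policies: `π t s₀ (w_1, …, w_t)` is the action `a_{t+1}`. -/
abbrev Policy (S A W : Type*) := (t : ℕ) → S → (Fin t → W) → A

namespace ControlledMarkovProcess

variable {S A W : Type*} (T : ControlledMarkovProcess S A W)

/-- The state `s_t` reached from `s₀` under the policy `π` and the disturbances `w_1, …, w_t`. -/
def state (π : Policy S A W) (s₀ : S) : (t : ℕ) → (Fin t → W) → S
  | 0, _ => s₀
  | t + 1, w =>
      T.F (state π s₀ t (fun i => w i.castSucc)) (π t s₀ (fun i => w i.castSucc)) (w (Fin.last t))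

/-- The joint law of `(s₀, w_1, …, w_t)` under the policy `π`, when `s₀` has law `ν`. -/
def historyLaw (ν : PMF S) (π : Policy S A W) : (t : ℕ) → PMF (S × (Fin t → W))
  | 0 => ν.map fun s₀ => (s₀, fun i => i.elim0)
  | t + 1 => (historyLaw ν π t).bind fun φ =>
      (T.PW (T.state π φ.1 t φ.2) (π t φ.1 φ.2)).map fun w' =>
        (φ.1, Fin.snoc (α := fun _ => W) φ.2 w')

/-- The expected reward `E g (s_t, a_{t+1})`. -/
def expectedReward [Fintype S] [Fintype W] (ν : PMF S) (π : Policy S A W) (t : ℕ) : ℝ :=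
  expect (T.historyLaw ν π t) fun φ => T.g (T.state π φ.1 t φ.2) (π t φ.1 φ.2)

/-- The average reward
`J (ν, π) = liminf_N (1/N) ∑_{t=1}^N E g (s_{t-1}, a_t)`. -/
def averageReward [Fintype S] [Fintype W] (ν : PMF S) (π : Policy S A W) : ℝ :=
  liminf (fun N : ℕ => (1 / (N : ℝ)) * ∑ t ∈ Finset.range N, T.expectedReward ν π t) atTop

/-- The state reached from `s₀` when the action in state `s` always is `μ s`. -/
def stationaryState (μ : S → A) (s₀ : S) : (t : ℕ) → (Fin t → W) → S
  | 0, _ => s₀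
  | t + 1, w =>
      T.F (stationaryState μ s₀ t (fun i => w i.castSucc))
        (μ (stationaryState μ s₀ t (fun i => w i.castSucc))) (w (Fin.last t))

/-- The stationary deterministic policy `a_{t+1} = μ (s_t)`. -/
def stationaryPolicy (μ : S → A) : Policy S A W :=
  fun t s₀ w => μ (T.stationaryState μ s₀ t w)

/-- Under the stationary policy of `μ`, the state process is the one that `μ` generates. -/
theorem state_stationaryPolicy (μ : S → A) (s₀ : S) (t : ℕ) (w : Fin t → W) :
    T.state (T.stationaryPolicy μ) s₀ t w = T.stationaryState μ s₀ t w := by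
  induction t with
  | zero => rfl
  | succ t ih => simp only [state, stationaryState, ih, stationaryPolicy]

/-- Under the stationary policy of `μ` the action is `μ` of the current state. -/
theorem stationaryPolicy_apply (μ : S → A) (s₀ : S) (t : ℕ) (w : Fin t → W) :
    T.stationaryPolicy μ t s₀ w = μ (T.state (T.stationaryPolicy μ) s₀ t w) := by
  rw [state_stationaryPolicy]; rfl

/-- `π` maximises the average reward from the initial law `ν`
among all history-dependent deterministic policies. -/
def IsOptimalFrom [Fintype S] [Fintype W] (ν : PMF S) (π : Policy S A W) : Prop :=
  ∀ π' : Policy S A W, T.averageReward ν π' ≤ T.averageReward ν π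

/-- `π` attains the best average reward over all policies and all initial laws, from some
initial law. -/
def IsOptimal [Fintype S] [Fintype W] (π : Policy S A W) : Prop :=
  ∃ ν : PMF S, ∀ (ν' : PMF S) (π' : Policy S A W), T.averageReward ν' π' ≤ T.averageReward ν π

end ControlledMarkovProcess

/-! ### Real-time coding with lookahead, feedback and a finite-memory decoder -/

/-- The data of a real-time coding problem with lookahead `d`, unit-delay noise-free feedback and
a time-invariant finite-memory decoder: source alphabet `U`, channel input alphabet `X`, channel
output alphabet `Y`, memory alphabet `Z`, reconstruction alphabet `R`. -/
structure CodingProblem (U X Y Z R : Type*) where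
  /-- lookahead -/
  d : ℕ
  /-- law of a source symbol -/
  PU : PMF U
  /-- transition law of the memoryless channel -/
  channel : X → PMF Y
  /-- memory update, `Z_i = fm Z_{i-1} Y_i` -/
  fm : Z → Y → Z
  /-- distortion -/
  dist : U → R → ℝ

namespace CodingProblem

variable {U X Y Z R : Type*} (P : CodingProblem U X Y Z R)

/-- Blocks `(u_1, …, u_{d+1})` of `d + 1` source symbols; `V_i = (U_i, …, U_{i+d})`. -/
abbrev Block := Fin (P.d + 1) → U

/-- The states `S_i = (V_i, Z_i)`. -/
abbrev State := P.Block × Z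

/-- The actions are the maps from blocks to channel inputs: `X_i = A_i (V_i)`. -/
abbrev Action := P.Block → X

/-- The disturbances `W_i = (V_i, Y_i)`. -/
abbrev Disturbance := P.Block × Y

/-- `shift (u_1, …, u_{d+1}) u' = (u_2, …, u_{d+1}, u')`. -/
def shift (v : P.Block) (u' : U) : P.Block :=
  Fin.snoc (α := fun _ => U) (Fin.tail v) u'

/-- The reward
`g (v, z, a) = - ∑_{u', y} P_U(u') P_{Y|X}(y | a (u_2, …, u_{d+1}, u')) Λ (u_2, fd (y, z))`, where
`u_2` is the first symbol of the shifted block (it is `u'` if `d = 0`). -/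
def reward [Fintype U] [Fintype Y] (fd : Y → Z → R) (s : P.State) (a : P.Action (X := X)) : ℝ :=
  -∑ u' : U, ∑ y : Y, (P.PU u').toReal * (P.channel (a (P.shift s.1 u')) y).toReal *
    P.dist (P.shift s.1 u' 0) (fd y s.2)

/-- The controlled Markov process of the coding problem with the stationary decoder
`fd (Y_i, Z_{i-1})`. The block moves to `shift v u'` with `u'` drawn from `P_U`, the channel input
is the value of the action at the new block, and the memory is updated by `fm`. -/
def process [Fintype U] [Fintype Y] (fd : Y → Z → R) :
    ControlledMarkovProcess P.State P.Action (P.Disturbance (Y := Y)) where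
  F s _ w := (w.1, P.fm s.2 w.2)
  PW s a := P.PU.bind fun u' =>
    (P.channel (a (P.shift s.1 u'))).map fun y => (P.shift s.1 u', y)
  g := P.reward fd

/-- The expression that is maximised over `a` in the average cost optimality equation:
`∑_{u', y} P_U(u') P_{Y|X}(y | a (u_2, …, u_{d+1}, u'))
  { h (u_2, …, u_{d+1}, u', fm (y, z)) - Λ (u_2, fd (y, z)) }`. -/
def acoeValue [Fintype U] [Fintype Y] (fd : Y → Z → R) (h : P.State → ℝ) (s : P.State)
    (a : P.Action (X := X)) : ℝ :=
  ∑ u' : U, ∑ y : Y, (P.PU u').toReal * (P.channel (a (P.shift s.1 u')) y).toReal *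
    (h (P.shift s.1 u', P.fm s.2 y) - P.dist (P.shift s.1 u' 0) (fd y s.2))

/-- `(lam, h)` solves the average cost optimality equation:
`lam + h (s) = max_a acoeValue (s, a)` for all states `s`. -/
def SolvesACOE [Fintype U] [Fintype Y] (fd : Y → Z → R) (lam : ℝ) (h : P.State → ℝ) : Prop :=
  ∀ s : P.State, IsGreatest (Set.range fun a : P.Action => P.acoeValue fd h s a) (lam + h s)

/-- `μ s` attains the maximum in the average cost optimality equation, for all states `s`. -/
def AttainsACOE [Fintype U] [Fintype Y] (fd : Y → Z → R) (h : P.State → ℝ)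
    (μ : P.State → P.Action) : Prop :=
  ∀ (s : P.State) (a : P.Action), P.acoeValue fd h s a ≤ P.acoeValue fd h s (μ s)

/-! The coding system itself. Time starts with `(U_0, …, U_d)` and `Z_0`, of joint law `ν`; the
symbols `U_{d+1}, U_{d+2}, …` are i.i.d. with law `P_U` and independent of these. -/

/-- Encoders with lookahead and feedback:
`f n z₀ (u_0, …, u_{n+1+d}) (y_1, …, y_n)` is the channel input `X_{n+1}`. -/
abbrev Encoder := (n : ℕ) → Z → (Fin (P.d + (n + 1) + 1) → U) → (Fin n → Y) → X

/-- The memory content `Z_n` after the channel outputs `y_1, …, y_n`. -/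
def memory (z₀ : Z) : (n : ℕ) → (Fin n → Y) → Z
  | 0, _ => z₀
  | n + 1, y => P.fm (memory z₀ n (fun i => y i.castSucc)) (y (Fin.last n))

/-- The joint law of `Z_0`, `(U_0, …, U_{n+d})` and `(Y_1, …, Y_n)` under the encoder `f`. -/
def systemLaw (ν : PMF P.State) (f : P.Encoder (X := X) (Y := Y) (Z := Z)) :
    (n : ℕ) → PMF (Z × (Fin (P.d + n + 1) → U) × (Fin n → Y))
  | 0 => ν.map fun s => (s.2, s.1, fun i => i.elim0)
  | n + 1 => (systemLaw ν f n).bind fun φ => P.PU.bind fun u' =>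
      (P.channel (f n φ.1 (Fin.snoc (α := fun _ => U) φ.2.1 u') φ.2.2)).map fun y' =>
        (φ.1, Fin.snoc (α := fun _ => U) φ.2.1 u', Fin.snoc (α := fun _ => Y) φ.2.2 y')

/-- The expected distortion `E Λ (U_{n+1}, fd (Y_{n+1}, Z_n))`. -/
def expectedDistortion [Fintype U] [Fintype Y] [Fintype Z] (ν : PMF P.State) (fd : Y → Z → R)
    (f : P.Encoder (X := X) (Y := Y) (Z := Z)) (n : ℕ) : ℝ :=
  expect (P.systemLaw ν f (n + 1)) fun φ =>
    P.dist (φ.2.1 ⟨n + 1, by omega⟩)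
      (fd (φ.2.2 (Fin.last n)) (P.memory φ.1 n fun i => φ.2.2 i.castSucc))

/-- The expected average distortion `limsup_N (1/N) ∑_{i=1}^N E Λ (U_i, fd (Y_i, Z_{i-1}))`. -/
def averageDistortion [Fintype U] [Fintype Y] [Fintype Z] (ν : PMF P.State) (fd : Y → Z → R)
    (f : P.Encoder (X := X) (Y := Y) (Z := Z)) : ℝ :=
  limsup (fun N : ℕ =>
    (1 / (N : ℝ)) * ∑ n ∈ Finset.range N, P.expectedDistortion ν fd f n) atTop

/-- The stationary encoder `X_i = m ((U_{i-1}, U_i, …, U_{i+d}), Z_{i-1})`. -/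
def stationaryEncoder (m : (Fin (P.d + 2) → U) → Z → X) :
    P.Encoder (X := X) (Y := Y) (Z := Z) :=
  fun n z₀ u y => m (fun j => u ⟨n + j, by omega⟩) (P.memory z₀ n y)

/-- The encoding function `m ((u_0, …, u_{d+1}), z) = μ ((u_0, …, u_d), z) (u_1, …, u_{d+1})`
of a map `μ` from states to actions. -/
def encodingFunction (μ : P.State → P.Action) : (Fin (P.d + 2) → U) → Z → X :=
  fun u z => μ (fun j => u j.castSucc, z) (fun j => u j.succ)

end CodingProblem

end RealTimeCoding

end

/-! Given the history, an encoder's next channel input depends only on the newest source symbol, so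
it is an action. Expected rewards under a policy and negated distortions under an encoder are thus
both runs of one finite controlled chain (`IsRun`), and it suffices to bound such runs.

Two certificates do this. If `c` is superharmonic and satisfies the optimality inequality up to
every `ε` (`IsGainBound`), telescoping bounds the long-run averages of any run by `expect ν c`. If
`c` is the gain of `μ` (`IsGain`), the averages under `μ` converge to `expect ν c`. One `c` with
both properties makes `μ` optimal for all `ν` at once, for the liminf of rewards and the limsup of
distortions alike.

Such a pair exists (`exists_optimal_gain`) by vanishing discount, with no assumption on the chain
structure: there are finitely many maps `μ`, so one is discount optimal for factors `β` arbitrarily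
near `1`. Its gain `c` is the limit of `(1 - β) v` along these `β`, and the discounted optimality
inequality passes to the limit. A solution of the ACOE is the special case of constant `c`. Joint
optimality follows because there are finitely many decoders. -/

noncomputable section

namespace RealTimeCoding

open Filter

/-! ### Finite expectations -/

section Expectation

variable {α β : Type*} [Fintype α] [Fintype β]

theorem sum_toReal_eq_one (p : PMF α) : ∑ x, (p x).toReal = 1 := by
  have h := p.tsum_coe
  rw [tsum_fintype] at h
  rw [← ENNReal.toReal_sum fun a _ => p.apply_ne_top a, h, ENNReal.toReal_one]

theorem expect_const (p : PMF α) (c : ℝ) : expect p (fun _ => c) = c := by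
  rw [expect, ← Finset.sum_mul, sum_toReal_eq_one, one_mul]

theorem expect_add (p : PMF α) (f g : α → ℝ) :
    expect p (fun x => f x + g x) = expect p f + expect p g := by
  simp only [expect, mul_add, Finset.sum_add_distrib]

theorem expect_neg (p : PMF α) (f : α → ℝ) : expect p (fun x => -f x) = -expect p f := by
  simp only [expect, mul_neg, Finset.sum_neg_distrib]

theorem expect_sub (p : PMF α) (f g : α → ℝ) :
    expect p (fun x => f x - g x) = expect p f - expect p g := by
  simp only [expect, mul_sub, Finset.sum_sub_distrib]

theorem expect_const_mul (p : PMF α) (c : ℝ) (f : α → ℝ) :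
    expect p (fun x => c * f x) = c * expect p f := by
  simp only [expect, Finset.mul_sum, mul_left_comm]

theorem expect_mono (p : PMF α) {f g : α → ℝ} (h : ∀ x, f x ≤ g x) : expect p f ≤ expect p g :=
  Finset.sum_le_sum fun x _ => mul_le_mul_of_nonneg_left (h x) ENNReal.toReal_nonneg

theorem expect_le_of_le (p : PMF α) {f : α → ℝ} {c : ℝ} (h : ∀ x, f x ≤ c) : expect p f ≤ c :=
  (expect_mono p h).trans_eq (expect_const p c)

theorem abs_expect_le (p : PMF α) {f : α → ℝ} {c : ℝ} (h : ∀ x, |f x| ≤ c) : |expect p f| ≤ c := by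
  rw [abs_le]
  refine ⟨?_, expect_le_of_le p fun x => (le_abs_self _).trans (h x)⟩
  rw [neg_le, ← expect_neg]
  exact expect_le_of_le p fun x => (neg_le_abs _).trans (h x)

theorem expect_bind (p : PMF α) (k : α → PMF β) (f : β → ℝ) :
    expect (p.bind k) f = expect p fun a => expect (k a) f := by
  have h (b : β) : (p.bind k b).toReal = ∑ a, (p a).toReal * (k a b).toReal := by
    rw [PMF.bind_apply, tsum_fintype, ENNReal.toReal_sum fun a _ =>
      ENNReal.mul_ne_top (p.apply_ne_top a) ((k a).apply_ne_top b)]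
    simp only [ENNReal.toReal_mul]
  simp only [expect, h, Finset.sum_mul, Finset.mul_sum, mul_assoc]
  exact Finset.sum_comm

theorem expect_pure (a : α) (f : α → ℝ) : expect (PMF.pure a) f = f a := by
  classical
  simp only [expect, PMF.pure_apply]
  rw [Finset.sum_eq_single a] <;> simp +contextual

theorem expect_map (p : PMF α) (k : α → β) (f : β → ℝ) :
    expect (p.map k) f = expect p fun a => f (k a) := by
  rw [← PMF.bind_pure_comp, expect_bind]
  simp only [Function.comp_apply, expect_pure]

end Expectation

/-! ### Bounding long-run averages by gains -/

section Runs

variable {S A : Type*} [Fintype S]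

/-- `r t` is the expected reward at time `t` of a controlled process with transition law `κ`,
reward `g` and initial law `ν`, whose actions may be chosen in any non-anticipating way. -/
def IsRun [Fintype A] (κ : S → A → PMF S) (g : S → A → ℝ) (ν : PMF S) (r : ℕ → ℝ) : Prop :=
  ∃ q : ℕ → PMF (S × A), (q 0).map Prod.fst = ν ∧
    (∀ t, (q (t + 1)).map Prod.fst = (q t).bind fun x => κ x.1 x.2) ∧
    ∀ t, r t = expect (q t) fun x => g x.1 x.2

/-- `r t` is the expected reward at time `t` of a Markov chain with transition law `κ s (μ s)`,
reward `g s (μ s)` and initial law `ν`. -/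
def IsStationaryRun (κ : S → A → PMF S) (g : S → A → ℝ) (μ : S → A) (ν : PMF S) (r : ℕ → ℝ) :
    Prop :=
  ∃ m : ℕ → PMF S, m 0 = ν ∧ (∀ t, m (t + 1) = (m t).bind fun s => κ s (μ s)) ∧
    ∀ t, r t = expect (m t) fun s => g s (μ s)

/-- `c` bounds the gain from above: it is superharmonic for every action and, up to any `ε`,
the optimality inequality with some relative value function holds. -/
def IsGainBound (κ : S → A → PMF S) (g : S → A → ℝ) (c : S → ℝ) : Prop :=
  (∀ s a, expect (κ s a) c ≤ c s) ∧
    ∀ ε > 0, ∃ h : S → ℝ, ∀ s a, g s a + expect (κ s a) h ≤ c s + h s + ε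

/-- `c` is the gain of `μ`, with some relative value function. -/
def IsGain (κ : S → A → PMF S) (g : S → A → ℝ) (μ : S → A) (c : S → ℝ) : Prop :=
  (∀ s, expect (κ s (μ s)) c = c s) ∧
    ∃ h : S → ℝ, ∀ s, g s (μ s) + expect (κ s (μ s)) h = c s + h s

variable {κ : S → A → PMF S} {g : S → A → ℝ} {ν : PMF S} {r : ℕ → ℝ} {c : S → ℝ}

theorem exists_abs_le {ι : Type*} [Finite ι] (f : ι → ℝ) : ∃ B, ∀ x, |f x| ≤ B := by
  obtain ⟨B, hB⟩ := (Set.finite_range fun x => |f x|).bddAbove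
  exact ⟨B, fun x => hB ⟨x, rfl⟩⟩

theorem IsRun.exists_abs_le [Fintype A] (hr : IsRun κ g ν r) : ∃ B, ∀ t, |r t| ≤ B := by
  obtain ⟨q, -, -, hq⟩ := hr
  obtain ⟨B, hB⟩ := RealTimeCoding.exists_abs_le fun x : S × A => g x.1 x.2
  exact ⟨B, fun t => hq t ▸ abs_expect_le _ hB⟩

/-- Superharmonicity keeps the mean of `c` at or below its initial value, and the terms in `h`
telescope to a bounded remainder. `K` depends on `ε` through `h`. -/
theorem IsRun.exists_sum_le [Fintype A] (hr : IsRun κ g ν r) (hc : IsGainBound κ g c) {ε : ℝ}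
    (hε : 0 < ε) : ∃ K, ∀ N : ℕ, ∑ t ∈ Finset.range N, r t ≤ N * (expect ν c + ε) + K := by
  obtain ⟨q, h0, hstep, hq⟩ := hr
  obtain ⟨h, hh⟩ := hc.2 ε hε
  obtain ⟨B, hB⟩ := RealTimeCoding.exists_abs_le h
  have fst (t : ℕ) (f : S → ℝ) :
      expect (q t) (fun x => f x.1) = expect ((q t).map Prod.fst) f := (expect_map ..).symm
  have next (t : ℕ) (f : S → ℝ) : expect (q t) (fun x => expect (κ x.1 x.2) f) =
      expect ((q (t + 1)).map Prod.fst) f := by rw [hstep, expect_bind]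
  have hcν (t : ℕ) : expect ((q t).map Prod.fst) c ≤ expect ν c := by
    induction t with
    | zero => exact (congrArg (expect · c) h0).le
    | succ t ih =>
      rw [← next]
      refine (expect_mono (q t) fun x => hc.1 x.1 x.2).trans ?_
      rw [fst]
      exact ih
  have hone (t : ℕ) : r t ≤ expect ν c + ε + (expect ((q t).map Prod.fst) h -
      expect ((q (t + 1)).map Prod.fst) h) := by
    have := expect_mono (q t) fun x => hh x.1 x.2
    rw [expect_add, expect_add, expect_add, expect_const, next, fst, fst, ← hq] at this
    linarith [hcν t]
  refine ⟨B + B, fun N => (Finset.sum_le_sum fun t _ => hone t).trans ?_⟩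
  rw [Finset.sum_add_distrib,
    Finset.sum_range_sub' fun t => expect ((q t).map Prod.fst) h]
  have h1 := abs_le.1 (abs_expect_le ((q 0).map Prod.fst) hB)
  have h2 := abs_le.1 (abs_expect_le ((q N).map Prod.fst) hB)
  simp only [Finset.sum_const, Finset.card_range, nsmul_eq_mul]
  linarith

/-- The same telescoping with equalities. A true limit results, so liminf and limsup agree. -/
theorem IsStationaryRun.tendsto {μ : S → A} (hr : IsStationaryRun κ g μ ν r)
    (hc : IsGain κ g μ c) :
    Tendsto (fun N : ℕ => (1 / (N : ℝ)) * ∑ t ∈ Finset.range N, r t) atTop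
      (nhds (expect ν c)) := by
  obtain ⟨m, h0, hstep, hq⟩ := hr
  obtain ⟨hinv, h, hh⟩ := hc
  obtain ⟨B, hB⟩ := RealTimeCoding.exists_abs_le h
  have next (t : ℕ) (f : S → ℝ) : expect (m t) (fun s => expect (κ s (μ s)) f) =
      expect (m (t + 1)) f := by rw [hstep, expect_bind]
  have hcν (t : ℕ) : expect (m t) c = expect ν c := by
    induction t with
    | zero => rw [h0]
    | succ t ih => rw [← next, funext hinv, ih]
  have hone (t : ℕ) : r t = expect ν c + (expect (m t) h - expect (m (t + 1)) h) := by
    have := congrArg (expect (m t)) (funext hh)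
    rw [expect_add, expect_add, next, ← hq] at this
    linarith [hcν t]
  have hsum (N : ℕ) : ∑ t ∈ Finset.range N, r t =
      N * expect ν c + (expect (m 0) h - expect (m N) h) := by
    rw [Finset.sum_congr rfl fun t _ => hone t, Finset.sum_add_distrib,
      Finset.sum_range_sub' fun t => expect (m t) h]
    simp
  have hlim : Tendsto (fun N : ℕ => (expect (m 0) h - expect (m N) h) * (1 / (N : ℝ))) atTop
      (nhds 0) := by
    refine bdd_le_mul_tendsto_zero' (B + B) (Eventually.of_forall fun N => ?_)
      tendsto_one_div_atTop_nhds_zero_nat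
    exact (abs_sub _ _).trans (add_le_add (abs_expect_le _ hB) (abs_expect_le _ hB))
  have := hlim.const_add (expect ν c)
  rw [add_zero] at this
  refine this.congr' ?_
  filter_upwards [eventually_gt_atTop 0] with N hN
  have : (N : ℝ) ≠ 0 := by positivity
  rw [hsum]
  field_simp

theorem abs_average_le {B : ℝ} (hB : ∀ t, |r t| ≤ B) (N : ℕ) :
    |(1 / (N : ℝ)) * ∑ t ∈ Finset.range N, r t| ≤ B := by
  -- At `N = 0` the average is `0`, because the sum is empty.
  rcases N.eq_zero_or_pos with rfl | hN
  · simpa using (abs_nonneg _).trans (hB 0)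
  have hN' : (0 : ℝ) < N := by positivity
  rw [abs_mul, abs_of_pos (by positivity), one_div, inv_mul_le_iff₀ hN']
  refine (Finset.abs_sum_le_sum_abs _ _).trans ((Finset.sum_le_sum fun t _ => hB t).trans ?_)
  simp

theorem IsRun.eventually_average_le [Fintype A] (hr : IsRun κ g ν r) (hc : IsGainBound κ g c)
    {ε : ℝ} (hε : 0 < ε) :
    ∀ᶠ N : ℕ in atTop, (1 / (N : ℝ)) * ∑ t ∈ Finset.range N, r t ≤ expect ν c + ε := by
  obtain ⟨K, hK⟩ := hr.exists_sum_le hc (half_pos hε)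
  have hlim := (tendsto_one_div_atTop_nhds_zero_nat (𝕜 := ℝ)).const_mul K
  rw [mul_zero] at hlim
  filter_upwards [hlim.eventually_lt_const (half_pos hε), eventually_gt_atTop 0] with N h1 hN
  have hN' : (0 : ℝ) < N := by positivity
  have := mul_le_mul_of_nonneg_left (hK N) (one_div_pos.2 hN').le
  have e : 1 / (N : ℝ) * (N * (expect ν c + ε / 2) + K) =
      expect ν c + ε / 2 + K * (1 / (N : ℝ)) := by field_simp
  linarith

theorem IsRun.liminf_average_le [Fintype A] (hr : IsRun κ g ν r) (hc : IsGainBound κ g c) :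
    liminf (fun N : ℕ => (1 / (N : ℝ)) * ∑ t ∈ Finset.range N, r t) atTop ≤ expect ν c := by
  obtain ⟨B, hB⟩ := hr.exists_abs_le
  refine le_of_forall_pos_le_add fun ε hε => liminf_le_of_frequently_le
    (hr.eventually_average_le hc hε).frequently ?_
  -- In `ℝ`, bounding a liminf from above requires the averages to be bounded below.
  exact isBoundedUnder_of ⟨-B, fun N => (abs_le.1 (abs_average_le hB N)).1⟩

theorem IsRun.le_limsup_average_neg [Fintype A] (hr : IsRun κ g ν r) (hc : IsGainBound κ g c) :
    -expect ν c ≤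
      limsup (fun N : ℕ => (1 / (N : ℝ)) * ∑ t ∈ Finset.range N, -r t) atTop := by
  obtain ⟨B, hB⟩ := hr.exists_abs_le
  refine le_of_forall_pos_le_add fun ε hε => ?_
  rw [← sub_le_iff_le_add]
  refine le_limsup_of_frequently_le ?_ ?_
  · refine ((hr.eventually_average_le hc hε).mono fun N hN => ?_).frequently
    rw [Finset.sum_neg_distrib, mul_neg]
    linarith
  · exact isBoundedUnder_of ⟨B, fun N =>
      (abs_le.1 (abs_average_le (fun t => (abs_neg (r t)).trans_le (hB t)) N)).2⟩

end Runs

/-! ### Existence of an optimal gain by vanishing discount -/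

section Existence

variable {S A : Type*} [Fintype S]

/-- The transition operator `f ↦ (s ↦ E f (s'))` of a Markov chain. -/
def transitionOp (k : S → PMF S) : (S → ℝ) →ₗ[ℝ] (S → ℝ) where
  toFun f s := expect (k s) f
  map_add' f f' := funext fun s => expect_add (k s) f f'
  map_smul' b f := funext fun s => expect_const_mul (k s) b f

theorem transitionOp_apply (k : S → PMF S) (f : S → ℝ) (s : S) :
    transitionOp k f s = expect (k s) f := rfl

/-- Let `P` be the operator. If `x = P y - y` is fixed by `P`, then `P^n y = y + n x`; averaging
keeps the left side bounded, so `x = 0`. -/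
theorem disjoint_ker_range_transitionOp_sub_id (k : S → PMF S) :
    Disjoint (LinearMap.ker (transitionOp k - LinearMap.id))
      (LinearMap.range (transitionOp k - LinearMap.id)) := by
  rw [Submodule.disjoint_def]
  rintro x hx ⟨y, rfl⟩
  set x := (transitionOp k - LinearMap.id : (S → ℝ) →ₗ[ℝ] (S → ℝ)) y with hxy
  have hPx : transitionOp k x = x := by
    simpa [sub_eq_zero] using hx
  have hPy : transitionOp k y = y + x := by simp [hxy]
  have hpow (n : ℕ) : (transitionOp k)^[n] y = y + (n : ℝ) • x := by
    induction n with
    | zero => simp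
    | succ n ih =>
      rw [Function.iterate_succ_apply', ih, map_add, map_smul, hPx, hPy]
      push_cast
      module
  obtain ⟨B, hB⟩ := exists_abs_le y
  have hbound (n : ℕ) (s : S) : |((transitionOp k)^[n] y) s| ≤ B := by
    induction n generalizing s with
    | zero => exact hB s
    | succ n ih =>
      rw [Function.iterate_succ_apply', transitionOp_apply]
      exact abs_expect_le _ ih
  funext s
  by_contra hs
  have hpos : 0 < |x s| := abs_pos.2 hs
  obtain ⟨n, hn⟩ := exists_nat_gt ((B + B) / |x s|)
  rw [div_lt_iff₀ hpos] at hn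
  have h1 := hbound n s
  rw [hpow] at h1
  have h2 : |(n : ℝ) * x s| ≤ B + B := by
    have := abs_sub (y s + (n : ℝ) * x s) (y s)
    rw [add_sub_cancel_left] at this
    exact this.trans (add_le_add h1 (hB s))
  rw [abs_mul, Nat.abs_cast] at h2
  linarith

/-- Each reward vector of a finite Markov chain has a gain and a relative value function. -/
theorem exists_gain (k : S → PMF S) (f : S → ℝ) :
    ∃ c h : S → ℝ, (∀ s, expect (k s) c = c s) ∧ ∀ s, f s + expect (k s) h = c s + h s := by
  set D : (S → ℝ) →ₗ[ℝ] (S → ℝ) := transitionOp k - LinearMap.id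
  -- By rank-nullity, disjointness makes kernel and range span. The splitting `f = c + (P - 1) w`
  -- then gives the gain `c` and relative value `-w`.
  have htop : LinearMap.ker D ⊔ LinearMap.range D = ⊤ := by
    refine Submodule.eq_top_of_disjoint _ _ ?_ (disjoint_ker_range_transitionOp_sub_id k)
    rw [add_comm, LinearMap.finrank_range_add_finrank_ker]
  obtain ⟨c, hc, _, ⟨w, rfl⟩, hcw⟩ := Submodule.mem_sup.1 (htop ▸ Submodule.mem_top (x := f))
  refine ⟨c, -w, fun s => ?_, fun s => ?_⟩
  · have := congrFun (LinearMap.mem_ker.1 hc) s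
    exact sub_eq_zero.1 this
  · have h1 : c s + (expect (k s) w - w s) = f s := congrFun hcw s
    have h2 : expect (k s) (-w) = -expect (k s) w := expect_neg _ _
    rw [h2, Pi.neg_apply]
    linarith

variable [Finite A] [Nonempty A] (κ : S → A → PMF S) (g : S → A → ℝ)

/-- The discounted optimality equation has a solution. -/
theorem exists_discounted {β : ℝ} (h0 : 0 ≤ β) (h1 : β < 1) :
    ∃ (v : S → ℝ) (μ : S → A), (∀ s a, g s a + β * expect (κ s a) v ≤ v s) ∧
      ∀ s, g s (μ s) + β * expect (κ s (μ s)) v = v s := by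
  let Q (v : S → ℝ) (s : S) (a : A) : ℝ := g s a + β * expect (κ s a) v
  let T (v : S → ℝ) (s : S) : ℝ := ⨆ a, Q v s a
  have hle (v : S → ℝ) (s : S) (a : A) : Q v s a ≤ T v s :=
    le_ciSup (Set.finite_range (Q v s)).bddAbove a
  -- The Bellman operator contracts the sup metric by `β`; its fixed point is the value function.
  have hT : ContractingWith ⟨β, h0⟩ T := by
    refine ⟨h1, LipschitzWith.of_dist_le_mul fun v w => ?_⟩
    have key (v w : S → ℝ) (s : S) : T v s ≤ T w s + β * dist v w := by
      refine ciSup_le fun a => ?_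
      have : expect (κ s a) v ≤ expect (κ s a) w + dist v w := by
        rw [← sub_le_iff_le_add', ← expect_sub]
        refine expect_le_of_le _ fun s' => ?_
        have := dist_le_pi_dist v w s'
        rw [Real.dist_eq] at this
        exact (le_abs_self _).trans this
      have h2 := mul_le_mul_of_nonneg_left this h0
      have h3 := hle w s a
      simp only [Q] at h3 ⊢
      linarith
    refine (dist_pi_le_iff (mul_nonneg h0 dist_nonneg)).2 fun s => ?_
    have h2 := key v w s
    have h3 := key w v s
    rw [dist_comm] at h3
    rw [Real.dist_eq, abs_le]
    constructor <;> linarith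
  set v := ContractingWith.fixedPoint T hT
  have hv : T v = v := hT.fixedPoint_isFixedPt
  have hex (s : S) : ∃ a, Q v s a = T v s := exists_eq_ciSup_of_finite
  choose μ hμ using hex
  exact ⟨v, μ, fun s a => (hle v s a).trans_eq (congrFun hv s),
    fun s => (hμ s).trans (congrFun hv s)⟩

/-- A single stationary policy is discount optimal for discount factors arbitrarily near `1`. -/
theorem exists_discount_optimal_near_one :
    ∃ μ : S → A, ∀ δ > 0, ∃ β : ℝ, 0 ≤ β ∧ β < 1 ∧ 1 - β < δ ∧ ∃ v : S → ℝ,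
      (∀ s a, g s a + β * expect (κ s a) v ≤ v s) ∧
      ∀ s, g s (μ s) + β * expect (κ s (μ s)) v = v s := by
  have hb (n : ℕ) : 0 ≤ 1 - 1 / ((n : ℝ) + 1) ∧ 1 - 1 / ((n : ℝ) + 1) < 1 := by
    have : 1 / ((n : ℝ) + 1) ≤ 1 := by
      rw [div_le_one (by positivity)]
      linarith [n.cast_nonneg (α := ℝ)]
    exact ⟨by linarith, by linarith [one_div_pos.2 (n.cast_add_one_pos (α := ℝ))]⟩
  choose v μ hv hμ using fun n => exists_discounted κ g (hb n).1 (hb n).2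
  -- Pigeonhole: finitely many maps serve infinitely many discount factors.
  obtain ⟨m, hm⟩ := Finite.exists_infinite_fiber μ
  refine ⟨m, fun δ hδ => ?_⟩
  obtain ⟨N, hN⟩ := exists_nat_one_div_lt hδ
  obtain ⟨n, hn, hNn⟩ := (Set.infinite_coe_iff.1 hm).exists_gt N
  refine ⟨_, (hb n).1, (hb n).2, ?_, v n, hv n, fun s => ?_⟩
  · rw [sub_sub_cancel]
    refine lt_of_le_of_lt ?_ hN
    exact one_div_le_one_div_of_le (by positivity) (by exact_mod_cast Nat.succ_le_succ hNn.le)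
  · have : μ n = m := hn
    exact this ▸ hμ n s

/-- The value of a stationary policy at discount factor `β` is its gain divided by `1 - β`, up to
a term that stays bounded as `β` tends to `1`. -/
theorem abs_discounted_sub_gain_le {k : S → PMF S} {f c h v : S → ℝ} {B β : ℝ}
    (hc : ∀ s, expect (k s) c = c s) (hh : ∀ s, f s + expect (k s) h = c s + h s)
    (hB : ∀ s, |h s| ≤ B) (h0 : 0 ≤ β) (h1 : β < 1)
    (hv : ∀ s, f s + β * expect (k s) v = v s) (s : S) :
    |(1 - β) * v s - c s| ≤ (1 - β) * (2 * B) := by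
  have hpos : 0 < 1 - β := sub_pos.2 h1
  -- Subtracting `(1 - β) h` cancels the first-order defect and leaves one of order `(1 - β) ^ 2`.
  -- Evaluating the recursion where `|e|` is maximal costs one factor `1 - β`.
  set e : S → ℝ := fun s => ((1 - β) * v s - c s) - (1 - β) * h s with he
  have hrec (s : S) : e s = β * expect (k s) e - (1 - β) ^ 2 * expect (k s) h := by
    simp only [he]
    rw [expect_sub, expect_sub, expect_const_mul, expect_const_mul, hc]
    linear_combination -(1 - β) * hv s + (1 - β) * hh s
  have : Nonempty S := ⟨s⟩
  obtain ⟨s₀, hs₀⟩ := Finite.exists_max fun s => |e s|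
  have hbound : |e s₀| ≤ (1 - β) * B := by
    have ha := abs_sub (β * expect (k s₀) e) ((1 - β) ^ 2 * expect (k s₀) h)
    rw [← hrec, abs_mul, abs_mul, abs_of_nonneg h0, abs_of_pos (pow_pos hpos 2)] at ha
    have hb := mul_le_mul_of_nonneg_left (abs_expect_le (k s₀) hs₀) h0
    have hd := mul_le_mul_of_nonneg_left (abs_expect_le (k s₀) hB) (pow_pos hpos 2).le
    have : (1 - β) * |e s₀| ≤ (1 - β) * ((1 - β) * B) := by linarith
    exact le_of_mul_le_mul_left this hpos
  have hes := (hs₀ s).trans hbound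
  have hhs := mul_le_mul_of_nonneg_left (hB s) hpos.le
  rw [← abs_of_pos hpos, ← abs_mul, abs_of_pos hpos] at hhs
  have := abs_add_le (e s) ((1 - β) * h s)
  have heq : (1 - β) * v s - c s = e s + (1 - β) * h s := by simp [he]
  rw [heq]
  linarith

/-- In a finite controlled process some stationary policy has a gain that bounds the gain of every
policy. -/
theorem exists_optimal_gain :
    ∃ (μ : S → A) (c : S → ℝ), IsGain κ g μ c ∧ IsGainBound κ g c := by
  obtain ⟨μ, hμ⟩ := exists_discount_optimal_near_one κ g
  obtain ⟨c, h, hc, hh⟩ := exists_gain (fun s => κ s (μ s)) fun s => g s (μ s)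
  obtain ⟨B, hB⟩ := exists_abs_le h
  obtain ⟨C, hC⟩ := exists_abs_le fun x : S × A => g x.1 x.2
  refine ⟨μ, c, ⟨hc, h, hh⟩, ?_⟩
  have happrox (ε : ℝ) (hε : 0 < ε) : ∃ β : ℝ, 0 ≤ β ∧ β < 1 ∧ 1 - β < ε ∧ ∃ v : S → ℝ,
      (∀ s a, g s a + β * expect (κ s a) v ≤ v s) ∧ ∀ s, |(1 - β) * v s - c s| ≤ ε := by
    have hM : 0 < 2 * |B| + 1 := by positivity
    obtain ⟨β, h0, h1, hδ, v, hv, hvμ⟩ := hμ (min ε (ε / (2 * |B| + 1)))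
      (lt_min hε (div_pos hε hM))
    refine ⟨β, h0, h1, hδ.trans_le (min_le_left _ _), v, hv, fun s =>
      (abs_discounted_sub_gain_le hc hh hB h0 h1 hvμ s).trans ?_⟩
    have h2 := hδ.trans_le (min_le_right _ _)
    rw [lt_div_iff₀ hM] at h2
    refine le_trans (mul_le_mul_of_nonneg_left ?_ (sub_nonneg.2 h1.le)) h2.le
    linarith [le_abs_self B]
  have hsuper (s : S) (a : A) : expect (κ s a) c ≤ c s := by
    obtain ⟨D, hD⟩ := exists_abs_le c
    refine le_of_forall_pos_le_add fun ε hε => ?_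
    -- Multiply the discounted inequality by `1 - β`. The error is `2 δ` from replacing `(1 - β) v`
    -- by `c` twice, `δ |C|` from the reward and `δ |D|` from replacing `β` by `1`.
    have hM : 0 < 2 + |C| + |D| := by positivity
    obtain ⟨β, h0, h1, hδ, v, hv, hvc⟩ := happrox (ε / (2 + |C| + |D|)) (div_pos hε hM)
    set δ := ε / (2 + |C| + |D|) with hδ'
    have hεδ : ε = δ * (2 + |C| + |D|) := by rw [hδ', div_mul_cancel₀ _ hM.ne']
    have hw : expect (κ s a) c ≤ expect (κ s a) (fun s => (1 - β) * v s + δ) :=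
      expect_mono _ fun s' => by linarith [(abs_le.1 (hvc s')).1]
    rw [expect_add, expect_const, expect_const_mul] at hw
    have h2 := mul_le_mul_of_nonneg_left hw h0
    have h3 := mul_le_mul_of_nonneg_left (hv s a) (sub_nonneg.2 h1.le)
    have h4 := (abs_le.1 (hvc s)).2
    have hg : -|C| ≤ g s a := by linarith [(abs_le.1 (hC (s, a))).1, le_abs_self C]
    have hec : expect (κ s a) c ≤ |D| :=
      (abs_le.1 (abs_expect_le _ hD)).2.trans (le_abs_self D)
    have h5 := mul_le_mul_of_nonneg_left hg (sub_nonneg.2 h1.le)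
    have h6 := mul_le_mul_of_nonneg_left hec (sub_nonneg.2 h1.le)
    have h7 : (1 - β) * |C| ≤ δ * |C| := by gcongr
    have h8 : (1 - β) * |D| ≤ δ * |D| := by gcongr
    have h9 : β * δ ≤ δ := mul_le_of_le_one_left (div_pos hε hM).le h1.le
    linarith
  refine ⟨hsuper, fun ε hε => ?_⟩
  obtain ⟨β, h0, h1, -, v, hv, hvc⟩ := happrox ε hε
  -- The discounted value serves as `h`: removing the factor `β` costs the mean of `(1 - β) v`, at
  -- most the mean of `c` plus `ε`, hence at most `c s + ε`.
  refine ⟨v, fun s a => ?_⟩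
  have hw : expect (κ s a) (fun s => (1 - β) * v s) ≤ expect (κ s a) (fun s => c s + ε) :=
    expect_mono _ fun s' => by linarith [(abs_le.1 (hvc s')).2]
  rw [expect_add, expect_const, expect_const_mul] at hw
  linarith [hv s a, hsuper s a]

end Existence

/-! ### Policies as runs -/

namespace ControlledMarkovProcess

variable {S A W : Type*} (T : ControlledMarkovProcess S A W)

/-- The law of the next state. -/
def kernel (s : S) (a : A) : PMF S := (T.PW s a).map (T.F s a)

theorem state_succ_snoc (π : Policy S A W) (s₀ : S) (t : ℕ) (w : Fin t → W) (w' : W) :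
    T.state π s₀ (t + 1) (Fin.snoc (α := fun _ => W) w w') =
      T.F (T.state π s₀ t w) (π t s₀ w) w' := by
  simp only [state, Fin.snoc_castSucc, Fin.snoc_last]

theorem map_state_historyLaw_succ (ν : PMF S) (π : Policy S A W) (t : ℕ) :
    (T.historyLaw ν π (t + 1)).map (fun φ => T.state π φ.1 (t + 1) φ.2) =
      (T.historyLaw ν π t).bind fun φ => T.kernel (T.state π φ.1 t φ.2) (π t φ.1 φ.2) := by
  simp only [historyLaw, PMF.map_bind, PMF.map_comp, kernel]
  congr! 3
  exact funext fun w' => T.state_succ_snoc ..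

theorem map_state_historyLaw_zero (ν : PMF S) (π : Policy S A W) :
    (T.historyLaw ν π 0).map (fun φ => T.state π φ.1 0 φ.2) = ν := by
  rw [historyLaw, PMF.map_comp]
  exact PMF.map_id ν

variable [Fintype S] [Fintype W]

theorem isRun_expectedReward [Fintype A] (ν : PMF S) (π : Policy S A W) :
    IsRun T.kernel T.g ν (T.expectedReward ν π) := by
  refine ⟨fun t => (T.historyLaw ν π t).map fun φ => (T.state π φ.1 t φ.2, π t φ.1 φ.2),
    ?_, fun t => ?_, fun t => ?_⟩
  · rw [PMF.map_comp]
    exact T.map_state_historyLaw_zero ν π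
  · rw [PMF.map_comp, PMF.bind_map]
    exact T.map_state_historyLaw_succ ν π t
  · rw [expect_map, expectedReward]

theorem isStationaryRun_expectedReward (ν : PMF S) (μ : S → A) :
    IsStationaryRun T.kernel T.g μ ν (T.expectedReward ν (T.stationaryPolicy μ)) := by
  refine ⟨fun t => (T.historyLaw ν (T.stationaryPolicy μ) t).map fun φ =>
    T.state (T.stationaryPolicy μ) φ.1 t φ.2, T.map_state_historyLaw_zero ν _, fun t => ?_,
    fun t => ?_⟩
  · refine (T.map_state_historyLaw_succ ν _ t).trans ?_
    rw [PMF.bind_map]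
    simp only [stationaryPolicy_apply, Function.comp_def]
  · rw [expect_map, expectedReward]
    simp only [stationaryPolicy_apply]

theorem averageReward_le [Fintype A] {c : S → ℝ} (hc : IsGainBound T.kernel T.g c) (ν : PMF S)
    (π : Policy S A W) : T.averageReward ν π ≤ expect ν c :=
  (T.isRun_expectedReward ν π).liminf_average_le hc

theorem averageReward_stationaryPolicy {μ : S → A} {c : S → ℝ} (hc : IsGain T.kernel T.g μ c)
    (ν : PMF S) : T.averageReward ν (T.stationaryPolicy μ) = expect ν c :=
  ((T.isStationaryRun_expectedReward ν μ).tendsto hc).liminf_eq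

theorem isOptimalFrom_stationaryPolicy [Fintype A] {μ : S → A} {c : S → ℝ}
    (hc : IsGain T.kernel T.g μ c) (hc' : IsGainBound T.kernel T.g c) (ν : PMF S) :
    T.IsOptimalFrom ν (T.stationaryPolicy μ) := fun π =>
  (T.averageReward_le hc' ν π).trans_eq (T.averageReward_stationaryPolicy hc ν).symm

theorem isOptimal_stationaryPolicy [Fintype A] [Nonempty S] {μ : S → A} {c : S → ℝ}
    (hc : IsGain T.kernel T.g μ c) (hc' : IsGainBound T.kernel T.g c) :
    T.IsOptimal (T.stationaryPolicy μ) := by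
  obtain ⟨s, hs⟩ := Finite.exists_max c
  -- The optimal value `expect ν c` is largest at a point mass where `c` is maximal.
  refine ⟨PMF.pure s, fun ν' π' => ?_⟩
  rw [T.averageReward_stationaryPolicy hc, expect_pure]
  exact (T.averageReward_le hc' ν' π').trans (expect_le_of_le ν' hs)

end ControlledMarkovProcess

/-! ### Encoders as runs of the same process -/

namespace CodingProblem

variable {U X Y Z R : Type*} (P : CodingProblem U X Y Z R)

/-- The current state `((U_n, …, U_{n+d}), Z_n)`, as a function of the history. -/
def currentState (n : ℕ) (φ : Z × (Fin (P.d + n + 1) → U) × (Fin n → Y)) : P.State :=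
  (fun j => φ.2.1 ⟨n + j, by omega⟩, P.memory φ.1 n φ.2.2)

/-- The action that the encoder `f` takes, as a function of the history: the channel input it
produces depends on the next block through its last symbol only. -/
def inducedAction (f : P.Encoder (X := X) (Y := Y) (Z := Z)) (n : ℕ)
    (φ : Z × (Fin (P.d + n + 1) → U) × (Fin n → Y)) : P.Action (X := X) :=
  fun v => f n φ.1 (Fin.snoc (α := fun _ => U) φ.2.1 (v (Fin.last P.d))) φ.2.2

theorem shift_last (v : P.Block) (u' : U) : P.shift v u' (Fin.last P.d) = u' :=
  Fin.snoc_last (α := fun _ => U) _ _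

theorem shift_castSucc (v : P.Block) (u' : U) (j : Fin P.d) :
    P.shift v u' j.castSucc = v j.succ :=
  Fin.snoc_castSucc (α := fun _ => U) _ _ j

/-- All index bookkeeping is here: the window starting at `n + 1` drops the oldest symbol of the
previous window and gains the new one. -/
theorem snoc_apply_eq_shift (n : ℕ) (u : Fin (P.d + n + 1) → U) (u' : U) (j : Fin (P.d + 1)) :
    (Fin.snoc (α := fun _ => U) u u' : Fin (P.d + (n + 1) + 1) → U) ⟨n + 1 + j, by omega⟩ =
      P.shift (fun j => u ⟨n + j, by omega⟩) u' j := by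
  induction j using Fin.lastCases with
  | last =>
    rw [shift_last]
    have : (⟨n + 1 + Fin.last P.d, by simp; omega⟩ : Fin (P.d + n + 1 + 1)) = Fin.last _ := by
      ext; simp; omega
    exact (congrArg (Fin.snoc (α := fun _ => U) u u') this).trans (Fin.snoc_last ..)
  | cast j =>
    rw [shift_castSucc]
    have : (⟨n + 1 + j.castSucc, by simp; omega⟩ : Fin (P.d + n + 1 + 1)) =
        Fin.castSucc ⟨n + j.succ, by simp; omega⟩ := by
      ext; simp; omega
    exact (congrArg (Fin.snoc (α := fun _ => U) u u') this).trans (Fin.snoc_castSucc ..)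

theorem currentState_succ (n : ℕ) (φ : Z × (Fin (P.d + n + 1) → U) × (Fin n → Y)) (u' : U)
    (y' : Y) :
    P.currentState (n + 1) (φ.1, Fin.snoc (α := fun _ => U) φ.2.1 u',
        Fin.snoc (α := fun _ => Y) φ.2.2 y') =
      (P.shift (P.currentState n φ).1 u', P.fm (P.currentState n φ).2 y') := by
  refine Prod.ext (funext fun j => P.snoc_apply_eq_shift n φ.2.1 u' j) ?_
  simp only [currentState, memory, Fin.snoc_castSucc, Fin.snoc_last]

theorem encoder_inducedAction (f : P.Encoder (X := X) (Y := Y) (Z := Z)) (n : ℕ)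
    (φ : Z × (Fin (P.d + n + 1) → U) × (Fin n → Y)) (v : P.Block) (u' : U) :
    P.inducedAction f n φ (P.shift v u') =
      f n φ.1 (Fin.snoc (α := fun _ => U) φ.2.1 u') φ.2.2 := by
  rw [inducedAction, shift_last]

theorem map_currentState_systemLaw_zero (ν : PMF P.State)
    (f : P.Encoder (X := X) (Y := Y) (Z := Z)) :
    (P.systemLaw ν f 0).map (P.currentState 0) = ν := by
  rw [systemLaw, PMF.map_comp]
  refine Eq.trans (congrArg (PMF.map · ν) (funext fun s => ?_)) (PMF.map_id ν)
  refine Prod.ext (funext fun j => congrArg s.1 ?_) rfl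
  ext
  simp

/-- The stationary encoder of `μ` takes the action of `μ`, at the blocks that can come next. -/
theorem inducedAction_stationaryEncoder_shift (μ : P.State → P.Action (X := X)) (n : ℕ)
    (φ : Z × (Fin (P.d + n + 1) → U) × (Fin n → Y)) (u' : U) :
    P.inducedAction (P.stationaryEncoder (P.encodingFunction μ)) n φ
        (P.shift (P.currentState n φ).1 u') =
      μ (P.currentState n φ) (P.shift (P.currentState n φ).1 u') := by
  rw [encoder_inducedAction, stationaryEncoder, encodingFunction]
  refine congr (congrArg μ (Prod.ext (funext fun j => ?_) rfl)) (funext fun j => ?_)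
  · exact Fin.snoc_castSucc (α := fun _ => U) (p := φ.2.1) (x := u') ⟨n + j, by omega⟩
  · refine Eq.trans (congrArg _ ?_) (P.snoc_apply_eq_shift n φ.2.1 u' j)
    ext
    simp
    omega

variable [Fintype U] [Fintype Y]

theorem kernel_process (fd : Y → Z → R) (s : P.State) (a : P.Action (X := X)) :
    (P.process fd).kernel s a = P.PU.bind fun u' =>
      (P.channel (a (P.shift s.1 u'))).map fun y => (P.shift s.1 u', P.fm s.2 y) := by
  simp only [ControlledMarkovProcess.kernel, process, PMF.map_bind, PMF.map_comp,
    Function.comp_def]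

theorem reward_eq_expect (fd : Y → Z → R) (s : P.State) (a : P.Action (X := X)) :
    P.reward fd s a = -expect P.PU fun u' => expect (P.channel (a (P.shift s.1 u'))) fun y =>
      P.dist (P.shift s.1 u' 0) (fd y s.2) := by
  simp only [reward, expect, Finset.mul_sum, mul_assoc]

theorem acoeValue_eq [Fintype Z] (fd : Y → Z → R) (h : P.State → ℝ) (s : P.State)
    (a : P.Action (X := X)) :
    P.acoeValue fd h s a = (P.process fd).g s a + expect ((P.process fd).kernel s a) h := by
  have hexp : expect ((P.process fd).kernel s a) h = expect P.PU fun u' =>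
      expect (P.channel (a (P.shift s.1 u'))) fun y => h (P.shift s.1 u', P.fm s.2 y) := by
    simp only [kernel_process, expect_bind, expect_map]
  rw [hexp]
  simp only [process, reward, acoeValue, expect, mul_sub, Finset.sum_sub_distrib,
    Finset.mul_sum, mul_assoc]
  ring

/-- The Markov property: the history affects the next state only through the current state and the
induced action. Encoders therefore need no translation into policies. -/
theorem map_currentState_systemLaw_succ (ν : PMF P.State) (fd : Y → Z → R)
    (f : P.Encoder (X := X) (Y := Y) (Z := Z)) (n : ℕ) :
    (P.systemLaw ν f (n + 1)).map (P.currentState (n + 1)) =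
      (P.systemLaw ν f n).bind fun φ =>
        (P.process fd).kernel (P.currentState n φ) (P.inducedAction f n φ) := by
  simp only [systemLaw, PMF.map_bind, PMF.map_comp, kernel_process, encoder_inducedAction]
  congr! 5
  exact funext fun y' => P.currentState_succ ..

variable [Fintype Z]

/-- Condition on the history and average over the new symbol and output; `U_{n+1}` heads the shifted
block. -/
theorem expectedDistortion_eq (ν : PMF P.State) (fd : Y → Z → R)
    (f : P.Encoder (X := X) (Y := Y) (Z := Z)) (n : ℕ) :
    P.expectedDistortion ν fd f n = -expect (P.systemLaw ν f n) fun φ =>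
      P.reward fd (P.currentState n φ) (P.inducedAction f n φ) := by
  rw [expectedDistortion, systemLaw, expect_bind, ← expect_neg]
  congr 1
  funext φ
  rw [expect_bind, reward_eq_expect, neg_neg]
  congr 1
  funext u'
  rw [expect_map, encoder_inducedAction]
  congr 1
  funext y'
  have h := P.snoc_apply_eq_shift n φ.2.1 u' 0
  simp only [Fin.snoc_last, Fin.snoc_castSucc]
  exact congrArg₂ P.dist h rfl

theorem isRun_neg_expectedDistortion [DecidableEq U] [Fintype X] (ν : PMF P.State) (fd : Y → Z → R)
    (f : P.Encoder (X := X) (Y := Y) (Z := Z)) :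
    IsRun (P.process fd).kernel (P.process fd).g ν fun n => -P.expectedDistortion ν fd f n := by
  refine ⟨fun n => (P.systemLaw ν f n).map fun φ => (P.currentState n φ, P.inducedAction f n φ),
    ?_, fun n => ?_, fun n => ?_⟩
  · rw [PMF.map_comp]
    exact P.map_currentState_systemLaw_zero ν f
  · rw [PMF.map_comp, PMF.bind_map]
    exact P.map_currentState_systemLaw_succ ν fd f n
  · rw [expect_map]
    beta_reduce
    rw [expectedDistortion_eq, neg_neg]
    rfl

/-- The induced action may differ from that of `μ` at blocks that cannot come next, but kernel and
reward evaluate actions only at shifted blocks. -/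
theorem isStationaryRun_neg_expectedDistortion (ν : PMF P.State) (fd : Y → Z → R)
    (μ : P.State → P.Action (X := X)) :
    IsStationaryRun (P.process fd).kernel (P.process fd).g μ ν fun n =>
      -P.expectedDistortion ν fd (P.stationaryEncoder (P.encodingFunction μ)) n := by
  refine ⟨fun n => (P.systemLaw ν (P.stationaryEncoder (P.encodingFunction μ)) n).map
    (P.currentState n), P.map_currentState_systemLaw_zero ν _, fun n => ?_, fun n => ?_⟩
  · refine (P.map_currentState_systemLaw_succ ν fd _ n).trans ?_
    rw [PMF.bind_map]
    simp only [kernel_process, inducedAction_stationaryEncoder_shift, Function.comp_def]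
  · rw [expect_map]
    beta_reduce
    rw [expectedDistortion_eq, neg_neg]
    simp only [process, reward_eq_expect, inducedAction_stationaryEncoder_shift]

theorem le_averageDistortion [DecidableEq U] [Fintype X] {fd : Y → Z → R} {c : P.State → ℝ}
    (hc : IsGainBound (P.process fd).kernel (P.process fd).g c) (ν : PMF P.State)
    (f : P.Encoder (X := X) (Y := Y) (Z := Z)) :
    -expect ν c ≤ P.averageDistortion ν fd f := by
  have := (P.isRun_neg_expectedDistortion ν fd f).le_limsup_average_neg hc
  simp only [neg_neg] at this
  exact this

theorem averageDistortion_stationaryEncoder {fd : Y → Z → R} {μ : P.State → P.Action (X := X)}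
    {c : P.State → ℝ} (hc : IsGain (P.process fd).kernel (P.process fd).g μ c)
    (ν : PMF P.State) :
    P.averageDistortion ν fd (P.stationaryEncoder (P.encodingFunction μ)) = -expect ν c := by
  have := ((P.isStationaryRun_neg_expectedDistortion ν fd μ).tendsto hc).neg
  simp only [Finset.sum_neg_distrib, mul_neg, neg_neg] at this
  exact this.limsup_eq

theorem averageDistortion_stationaryEncoder_le [DecidableEq U] [Fintype X] {fd : Y → Z → R}
    {μ : P.State → P.Action (X := X)} {c : P.State → ℝ}
    (hc : IsGain (P.process fd).kernel (P.process fd).g μ c)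
    (hc' : IsGainBound (P.process fd).kernel (P.process fd).g c) (ν : PMF P.State)
    (f : P.Encoder (X := X) (Y := Y) (Z := Z)) :
    P.averageDistortion ν fd (P.stationaryEncoder (P.encodingFunction μ)) ≤
      P.averageDistortion ν fd f :=
  (P.averageDistortion_stationaryEncoder hc ν).trans_le (P.le_averageDistortion hc' ν f)

/-- Constants are harmonic, and the same `h` works for every `ε`. -/
theorem SolvesACOE.isGainBound {fd : Y → Z → R} {lam : ℝ} {h : P.State → ℝ}
    (hs : P.SolvesACOE fd lam h) :
    IsGainBound (P.process fd).kernel (P.process fd).g fun _ => lam := by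
  refine ⟨fun s a => (expect_const _ _).le, fun ε hε => ⟨h, fun s a => ?_⟩⟩
  have : P.acoeValue fd h s a ≤ lam + h s := (hs s).2 ⟨a, rfl⟩
  rw [acoeValue_eq] at this
  linarith

theorem SolvesACOE.isGain {fd : Y → Z → R} {lam : ℝ} {h : P.State → ℝ}
    (hs : P.SolvesACOE fd lam h) {μ : P.State → P.Action (X := X)}
    (hμ : P.AttainsACOE fd h μ) :
    IsGain (P.process fd).kernel (P.process fd).g μ fun _ => lam := by
  refine ⟨fun s => expect_const _ _, h, fun s => ?_⟩
  obtain ⟨a, ha⟩ := (hs s).1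
  rw [← acoeValue_eq]
  exact le_antisymm ((hs s).2 ⟨μ s, rfl⟩) (ha.symm.trans_le (hμ s a))

end CodingProblem

end RealTimeCoding

end

/-! ### The theorem -/

theorem theorem4 {U X Y Z R : Type*} [Fintype U] [Fintype X] [Fintype Y] [Fintype Z] [Fintype R]
    [Nonempty X] [Nonempty Z] [Nonempty R]
    (P : RealTimeCoding.CodingProblem U X Y Z R) :
    -- for each stationary decoder there is a stationary encoding policy that is optimal
    (∀ fd : Y → Z → R, ∃ μ : P.State → P.Action,
      (P.process fd).IsOptimal ((P.process fd).stationaryPolicy μ) ∧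
      (∀ ν : PMF P.State,
        (P.process fd).IsOptimalFrom ν ((P.process fd).stationaryPolicy μ)) ∧
      (∀ (ν : PMF P.State) (f : P.Encoder),
        P.averageDistortion ν fd (P.stationaryEncoder (P.encodingFunction μ)) ≤
          P.averageDistortion ν fd f)) ∧
    -- joint optimality with an optimal stationary decoder
    (∀ ν : PMF P.State, ∃ (fd : Y → Z → R) (μ : P.State → P.Action),
      ∀ (fd' : Y → Z → R) (f : P.Encoder),
        P.averageDistortion ν fd (P.stationaryEncoder (P.encodingFunction μ)) ≤
          P.averageDistortion ν fd' f) ∧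
    -- each solution of the optimality equation yields such policies, through its maximisers
    (∀ (fd : Y → Z → R) (lam : ℝ) (h : P.State → ℝ), P.SolvesACOE fd lam h →
      (∃ μ : P.State → P.Action, P.AttainsACOE fd h μ) ∧
      ∀ μ : P.State → P.Action, P.AttainsACOE fd h μ → ∀ ν : PMF P.State,
        (P.process fd).averageReward ν ((P.process fd).stationaryPolicy μ) = lam ∧
        (P.process fd).IsOptimalFrom ν ((P.process fd).stationaryPolicy μ) ∧
        P.averageDistortion ν fd (P.stationaryEncoder (P.encodingFunction μ)) = -lam ∧
        ∀ f : P.Encoder,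
          P.averageDistortion ν fd (P.stationaryEncoder (P.encodingFunction μ)) ≤
            P.averageDistortion ν fd f) := by
  classical
  have : Nonempty U := P.PU.support_nonempty.to_type
  have key (fd : Y → Z → R) := RealTimeCoding.exists_optimal_gain
    (A := P.Action (X := X)) (P.process fd).kernel (P.process fd).g
  refine ⟨fun fd => ?_, fun ν => ?_, fun fd lam h hs => ⟨?_, fun μ hμ ν => ?_⟩⟩
  · obtain ⟨μ, c, hc, hc'⟩ := key fd
    exact ⟨μ, (P.process fd).isOptimal_stationaryPolicy hc hc',
      (P.process fd).isOptimalFrom_stationaryPolicy hc hc',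
      P.averageDistortion_stationaryEncoder_le hc hc'⟩
  · choose μ c hc hc' using key
    obtain ⟨fd, hfd⟩ := Finite.exists_min fun fd : Y → Z → R =>
      P.averageDistortion ν fd (P.stationaryEncoder (P.encodingFunction (μ fd)))
    exact ⟨fd, μ fd, fun fd' f => (hfd fd').trans
      (P.averageDistortion_stationaryEncoder_le (hc fd') (hc' fd') ν f)⟩
  · choose μ hμ using fun s => (hs s).1
    exact ⟨μ, fun s a => ((hs s).2 ⟨a, rfl⟩).trans_eq (hμ s).symm⟩
  · have hc := hs.isGain P hμ
    have hc' := hs.isGainBound P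
    refine ⟨?_, (P.process fd).isOptimalFrom_stationaryPolicy hc hc' ν, ?_,
      P.averageDistortion_stationaryEncoder_le hc hc' ν⟩
    · rw [(P.process fd).averageReward_stationaryPolicy hc, RealTimeCoding.expect_const]
    · rw [P.averageDistortion_stationaryEncoder hc, RealTimeCoding.expect_const]
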